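/- Let $k$ be an algebraically closed field of characteristic zero and let $n \geq 3$. Let $Q$ be the quiver with vertices $e_i$ and arrows $u_i : e_i \to e_{i+1}$, $d_i : e_{i+1} \to e_i$, for $i \in \mathbb{Z}/n$ (all indices are taken modulo $n$), and let $kQ$ be its path algebra, with the product $pq$ of paths meaning first $p$, then $q$ (and $pq = 0$ if the target of $p$ is not the source of $q$). For $\alpha, \beta, \gamma \in k^n$ let $H(\alpha,\beta,\gamma)$ be the quotient of $kQ$ by the two-sided ideal generated by the relations $$d_{i-1}u_{i-1}u_i = \alpha_i u_i d_i u_i + \beta_i u_i u_{i+1} d_{i+1} + \gamma_i u_i,$$ $$d_i d_{i-1} u_{i-1} = \alpha_i d_i u_i d_i + \beta_i u_{i+1} d_{i+1} d_i + \gamma_i d_i,$$ for all $i \in \mathbb{Z}/n$. Theorem. Let $\alpha, \alpha' \in k^n$ and $\beta, \beta' \in (k^\times)^n$. Then $H(\alpha,\beta,0) \cong H(\alpha',\beta',0)$ as $k$-algebras if and only if there exist $\lambda \in (k^\times)^n$ and $r \in \mathbb{Z}/n$ such that one of the following holds: 1. for all $i$, $\ \alpha_i' = \lambda_{i+r}\lambda_{i+r-1}^{-1}\alpha_{i+r}$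 and $\beta_i' = \lambda_{i+r+1}\lambda_{i+r-1}^{-1}\beta_{i+r}$; 2. for all $i$, $\ \alpha_i' = -\lambda_{-i-r}^{-1}\lambda_{-i-r-1}\beta_{-i-r-1}^{-1}\alpha_{-i-r-1}$ and $\beta_i' = \lambda_{-i-r}^{-1}\lambda_{-i-r-2}\,\beta_{-i-r-1}^{-1}$. -/

import Mathlib

noncomputable section

/-- A path of a quiver, together with its source and its target. -/
structure QuiverPath (V : Type*) [Quiver V] where
  src : V
  tgt : V
  path : Quiver.Path src tgt

/-- The path algebra `k Q` of a quiver `Q` with vertex set `V`: the `k`-vector space with basis the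
set of all paths of `Q` (the trivial ones included). -/
structure PathAlgebra (k V : Type*) [Field k] [Quiver V] where
  ofFinsupp ::
  toFinsupp : QuiverPath V →₀ k

namespace PathAlgebra

variable {k V : Type*} [Field k] [Quiver V]

theorem toFinsupp_injective :
    Function.Injective (toFinsupp : PathAlgebra k V → QuiverPath V →₀ k) := by
  rintro ⟨a⟩ ⟨b⟩ h
  exact congrArg _ h

/-- The product of two paths: `p q` if the target of `p` is the source of `q`, and `0` otherwise. -/
def concat (k : Type*) [Field k] [DecidableEq V] (p q : QuiverPath V) : QuiverPath V →₀ k :=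
  if h : p.tgt = q.src then
    Finsupp.single ⟨p.src, q.tgt, p.path.comp (h.symm ▸ q.path)⟩ 1
  else 0

/-- The bilinear extension of the product of paths. -/
def mulLin (k V : Type*) [Field k] [Quiver V] [DecidableEq V] :
    (QuiverPath V →₀ k) →ₗ[k] (QuiverPath V →₀ k) →ₗ[k] (QuiverPath V →₀ k) :=
  Finsupp.linearCombination k fun p => Finsupp.linearCombination k fun q => concat k p q

theorem mulLin_single [DecidableEq V] (p q : QuiverPath V) (a b : k) :
    mulLin k V (Finsupp.single p a) (Finsupp.single q b) = (a * b) • concat k p q := by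
  simp [mulLin, mul_smul]

theorem mulLin_assoc [DecidableEq V] (x y z : QuiverPath V →₀ k) :
    mulLin k V (mulLin k V x y) z = mulLin k V x (mulLin k V y z) := by
  induction x using Finsupp.induction_linear with
  | zero => simp
  | add x x' hx hx' => simp [hx, hx']
  | single p a =>
  induction y using Finsupp.induction_linear with
  | zero => simp
  | add y y' hy hy' => simp [hy, hy']
  | single q b =>
  induction z using Finsupp.induction_linear with
  | zero => simp
  | add z z' hz hz' => simp [hz, hz']
  | single r c =>
  obtain ⟨p1, p2, p⟩ := p
  obtain ⟨q1, q2, q⟩ := q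
  obtain ⟨r1, r2, r⟩ := r
  by_cases h : p2 = q1 <;> by_cases h' : q2 = r1 <;>
    (try subst h) <;> (try subst h') <;>
    simp [mulLin_single, concat, *, mul_assoc, -Finsupp.single_mul]

/-- The sum of all trivial paths. -/
def oneAux (k V : Type*) [Field k] [Quiver V] [Fintype V] : QuiverPath V →₀ k :=
  ∑ i : V, Finsupp.single ⟨i, i, Quiver.Path.nil⟩ 1

theorem oneAux_mulLin [DecidableEq V] [Fintype V] (x : QuiverPath V →₀ k) :
    mulLin k V (oneAux k V) x = x := by
  induction x using Finsupp.induction_linear with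
  | zero => simp
  | add x x' hx hx' => simp [hx, hx']
  | single p a =>
  obtain ⟨p1, p2, p⟩ := p
  rw [oneAux, map_sum, LinearMap.sum_apply, Finset.sum_eq_single p1]
  · simp [mulLin_single, concat]
  · intro i _ hi
    simp [mulLin_single, concat, hi]
  · simp

theorem mulLin_oneAux [DecidableEq V] [Fintype V] (x : QuiverPath V →₀ k) :
    mulLin k V x (oneAux k V) = x := by
  induction x using Finsupp.induction_linear with
  | zero => simp
  | add x x' hx hx' => simp [hx, hx']
  | single p a =>
  obtain ⟨p1, p2, p⟩ := p
  rw [oneAux, map_sum, Finset.sum_eq_single p2]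
  · simp [mulLin_single, concat]
  · intro i _ hi
    simp [mulLin_single, concat, hi.symm]
  · simp

instance : Zero (PathAlgebra k V) := ⟨⟨0⟩⟩
instance : Add (PathAlgebra k V) := ⟨fun x y => ⟨x.toFinsupp + y.toFinsupp⟩⟩
instance : Neg (PathAlgebra k V) := ⟨fun x => ⟨-x.toFinsupp⟩⟩
instance : Sub (PathAlgebra k V) := ⟨fun x y => ⟨x.toFinsupp - y.toFinsupp⟩⟩
instance {S : Type*} [SMulZeroClass S k] : SMul S (PathAlgebra k V) :=
  ⟨fun c x => ⟨c • x.toFinsupp⟩⟩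

instance : AddCommGroup (PathAlgebra k V) :=
  toFinsupp_injective.addCommGroup _ rfl (fun _ _ => rfl) (fun _ => rfl) (fun _ _ => rfl)
    (fun _ _ => rfl) (fun _ _ => rfl)

instance : Module k (PathAlgebra k V) :=
  toFinsupp_injective.module k ⟨⟨toFinsupp, rfl⟩, fun _ _ => rfl⟩ fun _ _ => rfl

/-- Multiplication is the bilinear extension of the concatenation of paths, and the unit is the sum
of the trivial paths. -/
instance [DecidableEq V] [Fintype V] : Ring (PathAlgebra k V) where
  mul x y := ⟨mulLin k V x.toFinsupp y.toFinsupp⟩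
  one := ⟨oneAux k V⟩
  mul_assoc x y z := toFinsupp_injective (mulLin_assoc _ _ _)
  one_mul x := toFinsupp_injective (oneAux_mulLin _)
  mul_one x := toFinsupp_injective (mulLin_oneAux _)
  zero_mul x := toFinsupp_injective (LinearMap.map_zero₂ _ _)
  mul_zero x := toFinsupp_injective (map_zero _)
  left_distrib x y z := toFinsupp_injective (map_add _ _ _)
  right_distrib x y z := toFinsupp_injective (LinearMap.map_add₂ _ _ _ _)
  zsmul := (· • ·)
  zsmul_zero' := zero_zsmul
  zsmul_succ' := fun n x => SubNegMonoid.zsmul_succ' n x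
  zsmul_neg' := fun n x => SubNegMonoid.zsmul_neg' n x
  neg_add_cancel := neg_add_cancel
  nsmul := (· • ·)
  nsmul_zero := zero_nsmul
  nsmul_succ := fun n x => AddMonoid.nsmul_succ n x
  sub_eq_add_neg := sub_eq_add_neg

instance [DecidableEq V] [Fintype V] : Algebra k (PathAlgebra k V) :=
  Algebra.ofModule (fun c _ _ => toFinsupp_injective (LinearMap.map_smul₂ _ c _ _))
    (fun c _ _ => toFinsupp_injective (map_smul _ c _))

/-- A path, as an element of the path algebra. -/
def ofPath (k : Type*) [Field k] {a b : V} (p : Quiver.Path a b) : PathAlgebra k V :=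
  ⟨Finsupp.single ⟨a, b, p⟩ 1⟩

/-- An arrow, as an element of the path algebra. -/
def ofArrow (k : Type*) [Field k] {a b : V} (f : a ⟶ b) : PathAlgebra k V :=
  ofPath k f.toPath

theorem ofPath_mul_ofPath [DecidableEq V] [Fintype V] {a b c : V} (p : Quiver.Path a b)
    (q : Quiver.Path b c) : ofPath k p * ofPath k q = ofPath k (p.comp q) := by
  refine toFinsupp_injective ((mulLin_single _ _ _ _).trans ?_)
  simp [concat, ofPath]

theorem ofPath_mul_ofPath_of_ne [DecidableEq V] [Fintype V] {a b c d : V} (p : Quiver.Path a b)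
    (q : Quiver.Path c d) (h : b ≠ c) : ofPath k p * ofPath k q = 0 := by
  refine toFinsupp_injective ((mulLin_single _ _ _ _).trans ?_)
  simp [concat, h]
  rfl

end PathAlgebra

/-- The vertices `e_0, …, e_{n-1}` of the doubled cyclic quiver, indexed modulo `n`. -/
def CyclicVertex (n : ℕ) : Type := ZMod n

instance (n : ℕ) : DecidableEq (CyclicVertex n) := inferInstanceAs (DecidableEq (ZMod n))

instance (n : ℕ) [NeZero n] : Fintype (CyclicVertex n) := inferInstanceAs (Fintype (ZMod n))

/-- The vertex `e_i`. -/
def CyclicVertex.mk {n : ℕ} (i : ZMod n) : CyclicVertex n := i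

/-- The arrows of the doubled cyclic quiver: for every `i` modulo `n` an arrow `u_i` from `e_i` to
`e_{i+1}` and an arrow `d_i` from `e_{i+1}` to `e_i`. -/
inductive CyclicArrow (n : ℕ) : CyclicVertex n → CyclicVertex n → Type
  | u (i : ZMod n) : CyclicArrow n (CyclicVertex.mk i) (CyclicVertex.mk (i + 1))
  | d (i : ZMod n) : CyclicArrow n (CyclicVertex.mk (i + 1)) (CyclicVertex.mk i)

/-- The doubled cyclic quiver (the double of the extended Dynkin quiver of type `A`). -/
instance (n : ℕ) : Quiver (CyclicVertex n) := ⟨CyclicArrow n⟩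

namespace QuiverDownUp

variable {k : Type*} [Field k] {n : ℕ}

/-- The arrow `u_i : e_i ⟶ e_{i+1}` in the path algebra. -/
def u (k : Type*) [Field k] {n : ℕ} (i : ZMod n) : PathAlgebra k (CyclicVertex n) :=
  PathAlgebra.ofArrow k
    (CyclicArrow.u i : CyclicVertex.mk i ⟶ CyclicVertex.mk (i + 1))

/-- The arrow `d_i : e_{i+1} ⟶ e_i` in the path algebra. -/
def d (k : Type*) [Field k] {n : ℕ} (i : ZMod n) : PathAlgebra k (CyclicVertex n) :=
  PathAlgebra.ofArrow k
    (CyclicArrow.d i : CyclicVertex.mk (i + 1) ⟶ CyclicVertex.mk i)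

/-- The defining relations of the quiver down-up algebra with parameters `α`, `β`, `γ`. -/
inductive Rel [NeZero n] (α β γ : ZMod n → k) :
    PathAlgebra k (CyclicVertex n) → PathAlgebra k (CyclicVertex n) → Prop
  | duu (i : ZMod n) : Rel α β γ (d k (i - 1) * u k (i - 1) * u k i)
      (α i • (u k i * d k i * u k i) + β i • (u k i * u k (i + 1) * d k (i + 1)) + γ i • u k i)
  | ddu (i : ZMod n) : Rel α β γ (d k i * d k (i - 1) * u k (i - 1))
      (α i • (d k i * u k i * d k i) + β i • (u k (i + 1) * d k (i + 1) * d k i) + γ i • d k i)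

end QuiverDownUp

/-- The quiver down-up algebra `H(α, β, γ)`: the quotient of the path algebra of the doubled cyclic
quiver on `n` vertices by the two-sided ideal generated by the relations. -/
abbrev QuiverDownUpAlgebra {k : Type*} [Field k] {n : ℕ} [NeZero n] (α β γ : ZMod n → k) :=
  RingQuot (QuiverDownUp.Rel α β γ)

end

/-! Sufficiency: a rotation or a reflection of the cycle, combined with a rescaling of the arrows,
carries the relations of one algebra to those of the other. The scalars `p i`, `q i` on `u_i`, `d_i`
enter only through `λ_i = p i * q i`. A reflection exchanges `u` with `d`, hence the relations `duu`
and `ddu`, and moves the `β`-term to the other side; this produces the inverse of `β` and the sign.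

Necessity: for `n ≥ 2` the one-dimensional representations are exactly the vertex characters
(`eq_vertexChar`). An isomorphism `φ` permutes them by some `σ`, so it preserves their common
kernel, the arrow ideal `J`, and `J²`. Since `γ = 0`, the relations are homogeneous and path length
is a grading. The degree-one part of `φ` sends an arrow between `e_i` and `e_{i+1}` to a nonzero
element between `e_{σ i}` and `e_{σ (i+1)}`. Thus `σ` preserves adjacency and, as `n ≥ 3`, is a
rotation or a reflection, while arrows go to nonzero multiples of arrows modulo `J²`. The
degree-three part of `φ` applied to `duu` involves only these multiples. Comparing it with a
relation of the target gives the equations for the parameters, because `udu`, `uud` (respectively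
`dud`, `udd`) are linearly independent. That independence needs `β ≠ 0` and is seen on the
representation `shiftRep`. -/

noncomputable section

/-! ### Universal property of the path algebra -/

namespace PathAlgebra

variable {k V B : Type*} [Field k] [Quiver V] [Ring B] [Algebra k B]

/-- The product in `B` of elements assigned to the arrows of a path. -/
def pathProd (E : V → B) (F : ∀ {a b : V}, (a ⟶ b) → B) {a : V} : ∀ {b : V}, Quiver.Path a b → B
  | _, .nil => E a
  | _, .cons p f => pathProd E F p * F f

section

variable {E : V → B} {F : ∀ {a b : V}, (a ⟶ b) → B}

theorem pathProd_mul_right (hE : ∀ a, E a * E a = E a)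
    (hr : ∀ {a b : V} (f : a ⟶ b), F f * E b = F f) {a b : V} (p : Quiver.Path a b) :
    pathProd E F p * E b = pathProd E F p := by
  cases p with
  | nil => exact hE a
  | cons p f => rw [pathProd, mul_assoc, hr]

/-- The product begins with the factor `E a`, so idempotency suffices and no condition `E a * F f =
F f` is needed. -/
theorem mul_pathProd_left (hE : ∀ a, E a * E a = E a) {a b : V} (p : Quiver.Path a b) :
    E a * pathProd E F p = pathProd E F p := by
  induction p with
  | nil => exact hE a
  | cons p f ih => rw [pathProd, ← mul_assoc, ih]

theorem pathProd_comp (hE : ∀ a, E a * E a = E a)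
    (hr : ∀ {a b : V} (f : a ⟶ b), F f * E b = F f) {a b c : V} (p : Quiver.Path a b)
    (q : Quiver.Path b c) :
    pathProd E F (p.comp q) = pathProd E F p * pathProd E F q := by
  induction q with
  | nil => exact (pathProd_mul_right hE hr p).symm
  | cons q f ih => rw [Quiver.Path.comp_cons, pathProd, ih, pathProd, mul_assoc]

end

/-- The coordinates with respect to the basis of paths, as a linear map. -/
def toFinsuppLin (k V : Type*) [Field k] [Quiver V] : PathAlgebra k V →ₗ[k] QuiverPath V →₀ k where
  toFun := toFinsupp
  map_add' _ _ := rfl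
  map_smul' _ _ := rfl

theorem span_ofPath (k V : Type*) [Field k] [Quiver V] :
    Submodule.span k (Set.range fun p : QuiverPath V => ofPath k p.path) = ⊤ := by
  rw [eq_top_iff]
  rintro ⟨x⟩ -
  induction x using Finsupp.induction_linear with
  | zero => exact zero_mem _
  | add x y hx hy => exact add_mem hx hy
  | single p a =>
    have : (⟨Finsupp.single p a⟩ : PathAlgebra k V) = a • ofPath k p.path :=
      toFinsupp_injective (by
        change Finsupp.single p a = a • Finsupp.single p 1
        simp)
    rw [this]
    exact Submodule.smul_mem _ _ (Submodule.subset_span ⟨p, rfl⟩)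

variable [DecidableEq V] [Fintype V]

theorem one_eq_sum : (1 : PathAlgebra k V) = ∑ i : V, ofPath k (Quiver.Path.nil : Quiver.Path i i) :=
  toFinsupp_injective (by
    change oneAux k V = toFinsuppLin k V _
    rw [map_sum]
    rfl)

/-- The universal property of the path algebra. -/
def lift (E : V → B) (F : ∀ {a b : V}, (a ⟶ b) → B) (hE : ∀ a, E a * E a = E a)
    (hE' : ∀ a b, a ≠ b → E a * E b = 0) (h1 : ∑ a, E a = 1)
    (hr : ∀ {a b : V} (f : a ⟶ b), F f * E b = F f) : PathAlgebra k V →ₐ[k] B :=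
  AlgHom.ofLinearMap
    ((Finsupp.linearCombination k fun p : QuiverPath V => pathProd E F p.path) ∘ₗ toFinsuppLin k V)
    (by
      rw [one_eq_sum, map_sum, ← h1]
      refine Finset.sum_congr rfl fun i _ => ?_
      simp [toFinsuppLin, ofPath, pathProd])
    (by
      rintro ⟨x⟩ ⟨y⟩
      change Finsupp.linearCombination k _ (mulLin k V x y) =
        Finsupp.linearCombination k _ x * Finsupp.linearCombination k _ y
      induction x using Finsupp.induction_linear with
      | zero => simp
      | add x x' hx hx' => simp [hx, hx', add_mul]
      | single p a =>
      induction y using Finsupp.induction_linear with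
      | zero => simp
      | add y y' hy hy' => simp only [hy, hy', mul_add, map_add]
      | single q b =>
      obtain ⟨p1, p2, p⟩ := p
      obtain ⟨q1, q2, q⟩ := q
      rw [mulLin_single]
      by_cases h : p2 = q1
      · subst h
        simp [concat, pathProd_comp hE hr, smul_smul, mul_comm b a, -Finsupp.single_mul]
      -- The orthogonal idempotents `E p2` and `E q1` can be inserted between the two factors.
      · have : pathProd E F p * pathProd E F q = 0 := by
          rw [← pathProd_mul_right hE hr p, ← mul_pathProd_left hE q, mul_assoc,
            ← mul_assoc (E p2), hE' _ _ h, zero_mul, mul_zero]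
        simp [concat, h, this])

theorem lift_ofPath (E : V → B) (F : ∀ {a b : V}, (a ⟶ b) → B) (hE : ∀ a, E a * E a = E a)
    (hE' : ∀ a b, a ≠ b → E a * E b = 0) (h1 : ∑ a, E a = 1)
    (hr : ∀ {a b : V} (f : a ⟶ b), F f * E b = F f) {a b : V} (p : Quiver.Path a b) :
    lift (k := k) E F hE hE' h1 hr (ofPath k p) = pathProd E F p := by
  change Finsupp.linearCombination k _ (Finsupp.single _ _) = _
  simp

theorem ofPath_cons {a b c : V} (p : Quiver.Path a b) (f : b ⟶ c) :
    ofPath k (p.cons f) = ofPath k p * ofArrow k f :=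
  (ofPath_mul_ofPath p f.toPath).symm

theorem algHom_ext {f g : PathAlgebra k V →ₐ[k] B}
    (h0 : ∀ a : V, f (ofPath k (.nil : Quiver.Path a a)) = g (ofPath k (.nil : Quiver.Path a a)))
    (h1 : ∀ {a b : V} (x : a ⟶ b), f (ofArrow k x) = g (ofArrow k x)) : f = g := by
  have : f.toLinearMap = g.toLinearMap := by
    refine LinearMap.ext_on_range (span_ofPath k V) ?_
    rintro ⟨a, b, p⟩
    change f (ofPath k p) = g (ofPath k p)
    induction p with
    | nil => exact h0 a
    | cons p x ih => rw [ofPath_cons, map_mul, map_mul, ih, h1]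
  exact AlgHom.toLinearMap_injective this

end PathAlgebra

end

/-! ### Universal property of `H(α, β, 0)` -/

noncomputable section

namespace QuiverDownUp

variable {k : Type*} [Field k] {n : ℕ} [NeZero n] {α β α' β' : ZMod n → k}

/-- Elements of an algebra `B` that satisfy the relations between the trivial paths `e_i` and the
arrows `u_i`, `d_i` in `H(α, β, 0)`. -/
structure Gens {n : ℕ} [NeZero n] (α β : ZMod n → k) (B : Type*) [Ring B] [Algebra k B] where
  E : ZMod n → B
  U : ZMod n → B
  D : ZMod n → B
  E_mul_self : ∀ i, E i * E i = E i
  E_mul_of_ne : ∀ i j, i ≠ j → E i * E j = 0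
  sum_E : ∑ i, E i = 1
  E_mul_U : ∀ i, E i * U i = U i
  U_mul_E : ∀ i, U i * E (i + 1) = U i
  E_mul_D : ∀ i, E (i + 1) * D i = D i
  D_mul_E : ∀ i, D i * E i = D i
  duu : ∀ i, D (i - 1) * U (i - 1) * U i
    = α i • (U i * D i * U i) + β i • (U i * U (i + 1) * D (i + 1))
  ddu : ∀ i, D i * D (i - 1) * U (i - 1)
    = α i • (D i * U i * D i) + β i • (U (i + 1) * D (i + 1) * D i)

/-- The class of the trivial path at `e_i`. -/
def e (α β : ZMod n → k) (i : ZMod n) : QuiverDownUpAlgebra α β 0 :=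
  RingQuot.mkAlgHom k _ (PathAlgebra.ofPath k
    (Quiver.Path.nil : Quiver.Path (CyclicVertex.mk i) (CyclicVertex.mk i)))

/-- The class of the arrow `u_i`. -/
def up (α β : ZMod n → k) (i : ZMod n) : QuiverDownUpAlgebra α β 0 :=
  RingQuot.mkAlgHom k _ (u k i)

/-- The class of the arrow `d_i`. -/
def down (α β : ZMod n → k) (i : ZMod n) : QuiverDownUpAlgebra α β 0 :=
  RingQuot.mkAlgHom k _ (d k i)

/-- The generators of `H(α, β, 0)`. -/
def gens (α β : ZMod n → k) : Gens α β (QuiverDownUpAlgebra α β 0) where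
  E := e α β
  U := up α β
  D := down α β
  E_mul_self i := by
    rw [e, ← map_mul, PathAlgebra.ofPath_mul_ofPath]; rfl
  E_mul_of_ne i j h := by
    rw [e, e, ← map_mul, PathAlgebra.ofPath_mul_ofPath_of_ne (b := CyclicVertex.mk i)
      (c := CyclicVertex.mk j) _ _ h, map_zero]
  sum_E := by
    rw [← map_one (RingQuot.mkAlgHom k (Rel α β 0)), PathAlgebra.one_eq_sum, map_sum]
    rfl
  E_mul_U i := by
    rw [e, up, ← map_mul, u, PathAlgebra.ofArrow, PathAlgebra.ofPath_mul_ofPath,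
      Quiver.Path.nil_comp]
  U_mul_E i := by
    rw [e, up, ← map_mul, u, PathAlgebra.ofArrow, PathAlgebra.ofPath_mul_ofPath,
      Quiver.Path.comp_nil]
  E_mul_D i := by
    rw [e, down, ← map_mul, d, PathAlgebra.ofArrow, PathAlgebra.ofPath_mul_ofPath,
      Quiver.Path.nil_comp]
  D_mul_E i := by
    rw [e, down, ← map_mul, d, PathAlgebra.ofArrow, PathAlgebra.ofPath_mul_ofPath,
      Quiver.Path.comp_nil]
  duu i := by
    have := RingQuot.mkAlgHom_rel k (Rel.duu (α := α) (β := β) (γ := 0) i)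
    simp only [map_mul, map_add, map_smul, Pi.zero_apply, zero_smul, add_zero] at this
    exact this
  ddu i := by
    have := RingQuot.mkAlgHom_rel k (Rel.ddu (α := α) (β := β) (γ := 0) i)
    simp only [map_mul, map_add, map_smul, Pi.zero_apply, zero_smul, add_zero] at this
    exact this

theorem algHom_ext {B : Type*} [Ring B] [Algebra k B] {f g : QuiverDownUpAlgebra α β 0 →ₐ[k] B}
    (he : ∀ i, f (e α β i) = g (e α β i)) (hu : ∀ i, f (up α β i) = g (up α β i))
    (hd : ∀ i, f (down α β i) = g (down α β i)) : f = g := by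
  refine RingQuot.ringQuot_ext' _ _ _ (PathAlgebra.algHom_ext he ?_)
  rintro _ _ (i | i)
  exacts [hu i, hd i]

namespace Gens

variable {B : Type*} [Ring B] [Algebra k B]

/-- The images of the arrows of the doubled cyclic quiver. -/
def arrow (G : Gens α β B) : ∀ {a b : CyclicVertex n}, (a ⟶ b) → B
  | _, _, .u i => G.U i
  | _, _, .d i => G.D i

theorem arrow_mul_E (G : Gens α β B) {a b : CyclicVertex n} (f : a ⟶ b) :
    G.arrow f * G.E b = G.arrow f := by
  obtain i | i := f
  exacts [G.U_mul_E i, G.D_mul_E i]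

/-- The algebra homomorphism from the path algebra given by the generators. -/
def liftPath (G : Gens α β B) : PathAlgebra k (CyclicVertex n) →ₐ[k] B :=
  PathAlgebra.lift (V := CyclicVertex n) G.E G.arrow G.E_mul_self G.E_mul_of_ne G.sum_E
    G.arrow_mul_E

theorem liftPath_ofPath (G : Gens α β B) {a b : CyclicVertex n} (p : Quiver.Path a b) :
    G.liftPath (PathAlgebra.ofPath k p) = PathAlgebra.pathProd (V := CyclicVertex n) G.E G.arrow p :=
  PathAlgebra.lift_ofPath (V := CyclicVertex n) G.E G.arrow G.E_mul_self G.E_mul_of_ne G.sum_E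
    G.arrow_mul_E p

theorem liftPath_u (G : Gens α β B) (i : ZMod n) : G.liftPath (u k i) = G.U i :=
  (G.liftPath_ofPath _).trans (G.E_mul_U i)

theorem liftPath_d (G : Gens α β B) (i : ZMod n) : G.liftPath (d k i) = G.D i :=
  (G.liftPath_ofPath _).trans (G.E_mul_D i)

/-- The universal property of `H(α, β, 0)`. -/
def lift (G : Gens α β B) : QuiverDownUpAlgebra α β 0 →ₐ[k] B :=
  RingQuot.liftAlgHom k ⟨G.liftPath, by
    rintro _ _ (i | i)
    · simp [liftPath_u, liftPath_d, G.duu]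
    · simp [liftPath_u, liftPath_d, G.ddu]⟩

@[simp] theorem lift_e (G : Gens α β B) (i : ZMod n) : G.lift (e α β i) = G.E i :=
  (RingQuot.liftAlgHom_mkAlgHom_apply ..).trans (G.liftPath_ofPath _)

@[simp] theorem lift_up (G : Gens α β B) (i : ZMod n) : G.lift (up α β i) = G.U i :=
  (RingQuot.liftAlgHom_mkAlgHom_apply ..).trans (G.liftPath_u i)

@[simp] theorem lift_down (G : Gens α β B) (i : ZMod n) : G.lift (down α β i) = G.D i :=
  (RingQuot.liftAlgHom_mkAlgHom_apply ..).trans (G.liftPath_d i)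

end Gens

end QuiverDownUp

end

/-! ### Isomorphisms from rotations and reflections -/

noncomputable section

namespace QuiverDownUp

variable {k : Type*} [Field k] {n : ℕ} [NeZero n] {α β α' β' : ZMod n → k}

namespace Gens

variable {B : Type*} [Ring B] [Algebra k B]

/-- Rotation of the quiver, combined with a rescaling of the arrows. -/
def rotate (G : Gens α' β' B) (r : ZMod n) (p q : ZMod n → k)
    (hα : ∀ i, α' (i - r) * (p (i - 1) * q (i - 1)) = α i * (p i * q i))
    (hβ : ∀ i, β' (i - r) * (p (i - 1) * q (i - 1)) = β i * (p (i + 1) * q (i + 1))) :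
    Gens α β B where
  E i := G.E (i - r)
  U i := p i • G.U (i - r)
  D i := q i • G.D (i - r)
  E_mul_self i := G.E_mul_self _
  E_mul_of_ne i j h := G.E_mul_of_ne _ _ (by simpa using h)
  sum_E := by rw [← G.sum_E]; exact Equiv.sum_comp (Equiv.subRight r) G.E
  E_mul_U i := by rw [mul_smul_comm, G.E_mul_U]
  U_mul_E i := by rw [smul_mul_assoc, add_sub_right_comm, G.U_mul_E]
  E_mul_D i := by rw [mul_smul_comm, add_sub_right_comm, G.E_mul_D]
  D_mul_E i := by rw [smul_mul_assoc, G.D_mul_E]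
  duu i := by
    rw [add_sub_right_comm, sub_right_comm i 1 r]
    simp only [smul_mul_assoc, mul_smul_comm, smul_smul, G.duu (i - r), smul_add]
    congr 2
    · linear_combination p i * hα i
    · linear_combination p i * hβ i
  ddu i := by
    rw [add_sub_right_comm, sub_right_comm i 1 r]
    simp only [smul_mul_assoc, mul_smul_comm, smul_smul, G.ddu (i - r), smul_add]
    congr 2
    · linear_combination q i * hα i
    · linear_combination q i * hβ i

/-- Reflection of the quiver, combined with a rescaling of the arrows. -/
def reflect (G : Gens α' β' B) (s : ZMod n) (p q : ZMod n → k)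
    (hα : ∀ i, α' (s - i - 1) * (β i * (p (i + 1) * q (i + 1))) = -(α i * (p i * q i)))
    (hβ : ∀ i, β' (s - i - 1) * (β i * (p (i + 1) * q (i + 1))) = p (i - 1) * q (i - 1)) :
    Gens α β B where
  E i := G.E (s - i)
  U i := p i • G.D (s - i - 1)
  D i := q i • G.U (s - i - 1)
  E_mul_self i := G.E_mul_self _
  E_mul_of_ne i j h := G.E_mul_of_ne _ _ (by simpa using h)
  sum_E := by rw [← G.sum_E]; exact Equiv.sum_comp (Equiv.subLeft s) G.E
  E_mul_U i := by
    have := G.E_mul_D (s - i - 1)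
    rw [sub_add_cancel] at this
    rw [mul_smul_comm, this]
  U_mul_E i := by rw [smul_mul_assoc, ← sub_sub, G.D_mul_E]
  E_mul_D i := by rw [mul_smul_comm, ← sub_sub, G.E_mul_U]
  D_mul_E i := by
    have := G.U_mul_E (s - i - 1)
    rw [sub_add_cancel] at this
    rw [smul_mul_assoc, this]
  duu i := by
    have h1 : s - (i - 1) - 1 = s - i - 1 + 1 := by ring
    have h2 : s - (i + 1) - 1 = s - i - 1 - 1 := by ring
    rw [h1, h2]
    simp only [smul_mul_assoc, mul_smul_comm, smul_smul, G.ddu (s - i - 1), smul_add, ← add_assoc,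
      ← add_smul]
    -- Expanding the image of the `β`-term by `ddu` creates a second multiple of `D U D`. The left
    -- side has none, so the two must cancel, whence the sign in `hα`.
    have h3 : α i * (p i * (q i * p i)) + β i * (q (i + 1) * (p (i + 1) * p i * α' (s - i - 1)))
        = 0 := by linear_combination p i * hα i
    have h4 : p i * (p (i - 1) * q (i - 1))
        = β i * (q (i + 1) * (p (i + 1) * p i * β' (s - i - 1))) := by
      linear_combination -p i * hβ i
    rw [h3, h4, zero_smul, zero_add]
  ddu i := by
    have h1 : s - (i - 1) - 1 = s - i - 1 + 1 := by ring
    have h2 : s - (i + 1) - 1 = s - i - 1 - 1 := by ring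
    rw [h1, h2]
    simp only [smul_mul_assoc, mul_smul_comm, smul_smul, G.duu (s - i - 1), smul_add, ← add_assoc,
      ← add_smul]
    have h3 : α i * (q i * (p i * q i)) + β i * (q i * (q (i + 1) * p (i + 1) * α' (s - i - 1)))
        = 0 := by linear_combination q i * hα i
    have h4 : p (i - 1) * (q (i - 1) * q i)
        = β i * (q i * (q (i + 1) * p (i + 1) * β' (s - i - 1))) := by
      linear_combination -q i * hβ i
    rw [h3, h4, zero_smul, zero_add]

end Gens

/-- Only the products of the scalars on `u_i` and `d_i` matter, so `l` is put entirely on the `u_i`.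
The inverse rotates back with inverse scalars. -/
theorem algEquiv_of_rotate (r : ZMod n) (l : ZMod n → k) (hl : ∀ i, l i ≠ 0)
    (hα : ∀ i, α' (i - r) * l (i - 1) = α i * l i)
    (hβ : ∀ i, β' (i - r) * l (i - 1) = β i * l (i + 1)) :
    Nonempty (QuiverDownUpAlgebra α β 0 ≃ₐ[k] QuiverDownUpAlgebra α' β' 0) := by
  let f : Gens α β (QuiverDownUpAlgebra α' β' 0) := (gens α' β').rotate r l 1
    (fun i => by simpa using hα i) (fun i => by simpa using hβ i)
  let g : Gens α' β' (QuiverDownUpAlgebra α β 0) := (gens α β).rotate (-r) (fun j => (l (j + r))⁻¹) 1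
    (fun j => by
      have := hα (j + r)
      rw [add_sub_cancel_right, add_sub_right_comm] at this
      have h1 := hl (j - 1 + r)
      have h2 := hl (j + r)
      simp only [sub_neg_eq_add, Pi.one_apply, mul_one]
      field_simp
      linear_combination -this)
    (fun j => by
      have := hβ (j + r)
      rw [add_sub_cancel_right, add_sub_right_comm, add_right_comm] at this
      have h1 := hl (j - 1 + r)
      have h2 := hl (j + 1 + r)
      simp only [sub_neg_eq_add, Pi.one_apply, mul_one]
      field_simp
      linear_combination -this)
  refine ⟨AlgEquiv.ofAlgHom f.lift g.lift ?_ ?_⟩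
  · refine algHom_ext ?_ ?_ ?_ <;> intro i <;> simp [f, g, Gens.rotate, gens, hl]
  · refine algHom_ext ?_ ?_ ?_ <;> intro i <;> simp [f, g, Gens.rotate, gens, hl]

/-- The map on arrow indices `i ↦ s - i - 1` is an involution. As `u` and `d` are exchanged, a
scaling of the `u_i` is undone by a scaling of the `d_j`. -/
theorem algEquiv_of_reflect (hβ0 : ∀ i, β i ≠ 0) (s : ZMod n) (l : ZMod n → k) (hl : ∀ i, l i ≠ 0)
    (hα : ∀ i, α' (s - i - 1) * (β i * l (i + 1)) = -(α i * l i))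
    (hβ : ∀ i, β' (s - i - 1) * (β i * l (i + 1)) = l (i - 1)) :
    Nonempty (QuiverDownUpAlgebra α β 0 ≃ₐ[k] QuiverDownUpAlgebra α' β' 0) := by
  let f : Gens α β (QuiverDownUpAlgebra α' β' 0) := (gens α' β').reflect s l 1
    (fun i => by simpa using hα i) (fun i => by simpa using hβ i)
  let g : Gens α' β' (QuiverDownUpAlgebra α β 0) :=
    (gens α β).reflect s 1 (fun j => (l (s - j - 1))⁻¹)
    (fun j => by
      have h3 := hα (s - j - 1)
      have h4 := hβ (s - j - 1)
      have e1 : s - (s - j - 1) - 1 = j := by ring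
      have e2 : s - (j + 1) - 1 = s - j - 1 - 1 := by ring
      rw [e1] at h3 h4
      have h1 := hl (s - j - 1 - 1)
      have h2 := hl (s - j - 1)
      have h5 := hl (s - j - 1 + 1)
      simp only [Pi.one_apply, one_mul, e2]
      rw [← h4] at h1 ⊢
      -- This is `β' j ≠ 0`: by `hβ` it is a factor of a value of `l`.
      have h6 := left_ne_zero_of_mul h1
      have h7 := hβ0 (s - j - 1)
      field_simp
      linear_combination h3)
    (fun j => by
      have h4 := hβ (s - j - 1)
      have e1 : s - (s - j - 1) - 1 = j := by ring
      have e2 : s - (j + 1) - 1 = s - j - 1 - 1 := by ring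
      have e3 : s - (j - 1) - 1 = s - j - 1 + 1 := by ring
      rw [e1] at h4
      have h1 := hl (s - j - 1 - 1)
      have h5 := hl (s - j - 1 + 1)
      simp only [Pi.one_apply, one_mul, e2, e3]
      rw [← h4] at h1 ⊢
      have h6 := left_ne_zero_of_mul h1
      have h7 := hβ0 (s - j - 1)
      field_simp)
  have e1 (j : ZMod n) : s - (s - j - 1) - 1 = j := by ring
  refine ⟨AlgEquiv.ofAlgHom f.lift g.lift ?_ ?_⟩
  · refine algHom_ext ?_ ?_ ?_ <;> intro i <;> simp [f, g, Gens.reflect, gens, hl, e1]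
  · refine algHom_ext ?_ ?_ ?_ <;> intro i <;> simp [f, g, Gens.reflect, gens, hl, e1]

end QuiverDownUp

end

/-! ### Linear independence of cubic paths; one-dimensional representations -/

noncomputable section

namespace QuiverDownUp

variable {k : Type*} [Field k] {n : ℕ} [NeZero n] {α β α' β' : ZMod n → k}

/-- The representation of `H(α, β, 0)` by weighted shifts on functions on `ℤ/n × k × k`: at the
vertex `e_i` the paths `u_i d_i` and `d_{i-1} u_{i-1}` act as the two coordinates of `k × k`. -/
def shiftRep (α β : ZMod n → k) (hβ : ∀ i, β i ≠ 0) :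
    Gens α β (Module.End k (ZMod n → k → k → k)) where
  E i :=
    { toFun f j a b := if j = i then f j a b else 0
      map_add' f g := by ext j a b; simp only [Pi.add_apply]; split_ifs <;> simp
      map_smul' c f := by ext j a b; simp }
  -- If `u_i d_i` and `d_{i-1} u_{i-1}` are `a` and `b` at `e_i`, then `duu` forces `u_{i+1}
  -- d_{i+1}` to be `(b - α i * a) / β i` at `e_{i+1}`, where `d_i u_i` is `a`.
  U i :=
    { toFun f j a b := if j = i then f (i + 1) ((b - α i * a) / β i) a else 0
      map_add' f g := by ext j a b; simp only [Pi.add_apply]; split_ifs <;> simp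
      map_smul' c f := by ext j a b; simp }
  -- This is the inverse change of coordinates; the factor `b` makes `d_i u_i` act as `b` and `u_i
  -- d_i` as `a`.
  D i :=
    { toFun f j a b := if j = i + 1 then b * f i b (α i * b + β i * a) else 0
      map_add' f g := by ext j a b; simp only [Pi.add_apply]; split_ifs <;> simp [mul_add]
      map_smul' c f := by ext j a b; simp [mul_left_comm] }
  E_mul_self i := by
    refine LinearMap.ext fun f => ?_
    ext l a b
    by_cases h : l = i <;> simp [h]
  E_mul_of_ne i j h := by
    refine LinearMap.ext fun f => ?_
    ext l a b
    simp only [Module.End.mul_apply, LinearMap.coe_mk, AddHom.coe_mk, LinearMap.zero_apply,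
      Pi.zero_apply]
    split_ifs with h1 h2
    · exact absurd (h1.symm.trans h2) h
    · rfl
    · rfl
  sum_E := by
    refine LinearMap.ext fun f => ?_
    ext l a b
    simp [LinearMap.sum_apply, Finset.sum_apply]
  E_mul_U i := by
    refine LinearMap.ext fun f => ?_
    ext l a b
    by_cases h : l = i <;> simp [h]
  U_mul_E i := by
    refine LinearMap.ext fun f => ?_
    ext l a b
    simp
  E_mul_D i := by
    refine LinearMap.ext fun f => ?_
    ext l a b
    by_cases h : l = i + 1 <;> simp [h]
  D_mul_E i := by
    refine LinearMap.ext fun f => ?_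
    ext l a b
    simp
  duu i := by
    have h1 : ∀ j a b, α j * a + β j * ((b - α j * a) / β j) = b := fun j a b => by
      rw [mul_div_cancel₀ _ (hβ j), add_sub_cancel]
    have h2 : ∀ j a b, (α j * b + β j * a - α j * b) / β j = a := fun j a b => by
      rw [add_sub_cancel_left, mul_div_cancel_left₀ _ (hβ j)]
    refine LinearMap.ext fun f => ?_
    ext l a b
    by_cases h : l = i
    · simp only [h, Module.End.mul_apply, LinearMap.add_apply, LinearMap.smul_apply,
        LinearMap.coe_mk, AddHom.coe_mk, Pi.add_apply, Pi.smul_apply, sub_add_cancel, if_true,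
        h1, h2, smul_eq_mul]
      rw [← mul_assoc, ← mul_assoc, ← add_mul, mul_div_cancel₀ _ (hβ i), add_sub_cancel]
    · simp [h]
  ddu i := by
    have h1 : ∀ j a b, α j * a + β j * ((b - α j * a) / β j) = b := fun j a b => by
      rw [mul_div_cancel₀ _ (hβ j), add_sub_cancel]
    have h2 : ∀ j a b, (α j * b + β j * a - α j * b) / β j = a := fun j a b => by
      rw [add_sub_cancel_left, mul_div_cancel_left₀ _ (hβ j)]
    refine LinearMap.ext fun f => ?_
    ext l a b
    by_cases h : l = i + 1
    · simp only [h, Module.End.mul_apply, LinearMap.add_apply, LinearMap.smul_apply,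
        LinearMap.coe_mk, AddHom.coe_mk, Pi.add_apply, Pi.smul_apply, sub_add_cancel, if_true,
        h1, h2, smul_eq_mul]
      ring
    · simp [h]

theorem udu_uud_independent (hβ : ∀ i, β i ≠ 0) (i : ZMod n) {x y : k}
    (h : x • (up α β i * down α β i * up α β i) +
      y • (up α β i * up α β (i + 1) * down α β (i + 1)) = 0) : x = 0 ∧ y = 0 := by
  have h1 := congrArg (fun z => (shiftRep α β hβ).lift z (fun _ _ _ => 1) i) h
  have hb := hβ i
  -- On the constant function `1`, the paths `udu` and `uud` give `a` and `(b - α i * a) / β i` at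
  -- `e_i`. Each of the two points chosen kills one and makes the other `1`.
  have h2 := congrFun (congrFun h1 0) (β i)
  have h3 := congrFun (congrFun h1 1) (α i)
  simp [shiftRep, hb] at h2 h3
  exact ⟨h3, h2⟩

theorem dud_udd_independent (hβ : ∀ i, β i ≠ 0) (i : ZMod n) {x y : k}
    (h : x • (down α β i * up α β i * down α β i) +
      y • (up α β (i + 1) * down α β (i + 1) * down α β i) = 0) : x = 0 ∧ y = 0 := by
  have h1 := congrArg (fun z => (shiftRep α β hβ).lift z (fun _ _ _ => 1) (i + 1)) h
  -- On the constant function `1`, the paths `dud` and `udd` give `b ^ 2` and `a * b` at `e_{i+1}`.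
  have h2 := congrFun (congrFun h1 0) 1
  have h3 := congrFun (congrFun h1 1) 1
  simp [shiftRep] at h2 h3
  rw [mul_div_cancel₀ _ (hβ (i + 1)), add_sub_cancel, mul_one, h2, zero_add] at h3
  exact ⟨h2, h3⟩

theorem up_ne_zero (hβ : ∀ i, β i ≠ 0) (i : ZMod n) : up α β i ≠ 0 := fun h =>
  one_ne_zero (udu_uud_independent (α := α) (x := 1) (y := 0) hβ i (by simp [h])).1

theorem down_ne_zero (hβ : ∀ i, β i ≠ 0) (i : ZMod n) : down α β i ≠ 0 := fun h =>
  one_ne_zero (dud_udd_independent (α := α) (x := 1) (y := 0) hβ i (by simp [h])).1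

/-- The one-dimensional representation of `H(α, β, 0)` at the vertex `e_i`. -/
def vertexChar (α β : ZMod n → k) (i : ZMod n) : QuiverDownUpAlgebra α β 0 →ₐ[k] k :=
  Gens.lift
    { E := Pi.single i 1
      U := 0
      D := 0
      E_mul_self := fun j => by
        obtain rfl | h := eq_or_ne j i <;> simp [*]
      E_mul_of_ne := fun j l h => by
        obtain rfl | h' := eq_or_ne j i
        · simp [h.symm]
        · simp [h']
      sum_E := by simp
      E_mul_U := by simp
      U_mul_E := by simp
      E_mul_D := by simp
      D_mul_E := by simp
      duu := by simp
      ddu := by simp }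

@[simp] theorem vertexChar_e (i j : ZMod n) :
    vertexChar α β i (e α β j) = (Pi.single i 1 : ZMod n → k) j := Gens.lift_e ..

@[simp] theorem vertexChar_up (i j : ZMod n) : vertexChar α β i (up α β j) = 0 := Gens.lift_up ..

@[simp] theorem vertexChar_down (i j : ZMod n) : vertexChar α β i (down α β j) = 0 :=
  Gens.lift_down ..

theorem vertexChar_injective : Function.Injective (vertexChar α β) := by
  intro i j h
  by_contra hij
  have := DFunLike.congr_fun h (e α β i)
  simp [hij] at this

/-- For `n ≥ 2` the quiver has no loops, so that every one-dimensional representation of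
`H(α, β, 0)` is supported at a single vertex. -/
theorem eq_vertexChar (hn : 2 ≤ n) (f : QuiverDownUpAlgebra α β 0 →ₐ[k] k) :
    ∃ i, f = vertexChar α β i := by
  have : Fact (1 < n) := ⟨hn⟩
  have h1 : ∃ i, f (e α β i) ≠ 0 := by
    by_contra! h
    have := congrArg f (gens α β).sum_E
    rw [map_sum, map_one] at this
    exact zero_ne_one ((Finset.sum_eq_zero fun i _ => h i).symm.trans this)
  obtain ⟨i, hi⟩ := h1
  have h0 : ∀ j, j ≠ i → f (e α β j) = 0 := fun j hj => by
    have := congrArg f ((gens α β).E_mul_of_ne j i hj)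
    rw [map_mul, map_zero] at this
    exact (mul_eq_zero.1 this).resolve_right hi
  have hi1 : f (e α β i) = 1 := by
    have := congrArg f ((gens α β).E_mul_self i)
    rw [map_mul] at this
    exact mul_right_cancel₀ hi (this.trans (one_mul _).symm)
  have key : ∀ j, f (e α β j) = 0 ∨ f (e α β (j + 1)) = 0 := fun j => by
    by_cases hj : j = i
    · exact Or.inr (h0 _ (by rw [hj]; simp))
    · exact Or.inl (h0 _ hj)
  refine ⟨i, algHom_ext (fun j => ?_) (fun j => ?_) fun j => ?_⟩
  · obtain rfl | h := eq_or_ne j i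
    · simp [hi1]
    · simp [h0 j h, h]
  · rw [vertexChar_up]
    have e1 := congrArg f ((gens α β).E_mul_U j)
    have e2 := congrArg f ((gens α β).U_mul_E j)
    rw [map_mul] at e1 e2
    obtain h | h := key j
    · exact e1.symm.trans (mul_eq_zero_of_left h _)
    · exact e2.symm.trans (mul_eq_zero_of_right _ h)
  · rw [vertexChar_down]
    have e1 := congrArg f ((gens α β).E_mul_D j)
    have e2 := congrArg f ((gens α β).D_mul_E j)
    rw [map_mul] at e1 e2
    obtain h | h := key j
    · exact e2.symm.trans (mul_eq_zero_of_right _ h)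
    · exact e1.symm.trans (mul_eq_zero_of_left h _)

end QuiverDownUp

end

/-! ### Grading by path length and the arrow ideal -/

noncomputable section

namespace QuiverDownUp

open Polynomial

variable {k : Type*} [Field k] {n : ℕ} [NeZero n] {α β α' β' : ZMod n → k}

/-- The grading of `H(α, β, 0)` by path length, as an algebra homomorphism to the polynomial ring
that multiplies the homogeneous elements of degree `m` by `X ^ m`. -/
def gradingHom (α β : ZMod n → k) :
    QuiverDownUpAlgebra α β 0 →ₐ[k] (QuiverDownUpAlgebra α β 0)[X] :=
  Gens.lift
    { E := fun i => C (e α β i)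
      U := fun i => C (up α β i) * X
      D := fun i => C (down α β i) * X
      E_mul_self := fun i => by rw [← C_mul]; exact congrArg C ((gens α β).E_mul_self i)
      E_mul_of_ne := fun i j h => by
        rw [← C_mul, ← C_0]; exact congrArg C ((gens α β).E_mul_of_ne i j h)
      sum_E := by rw [← map_sum, ← C_1]; exact congrArg C (gens α β).sum_E
      E_mul_U := fun i => by
        rw [← mul_assoc, ← C_mul]; exact congrArg (C · * X) ((gens α β).E_mul_U i)
      U_mul_E := fun i => by
        rw [mul_assoc, X_mul_C, ← mul_assoc, ← C_mul]
        exact congrArg (C · * X) ((gens α β).U_mul_E i)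
      E_mul_D := fun i => by
        rw [← mul_assoc, ← C_mul]; exact congrArg (C · * X) ((gens α β).E_mul_D i)
      D_mul_E := fun i => by
        rw [mul_assoc, X_mul_C, ← mul_assoc, ← C_mul]
        exact congrArg (C · * X) ((gens α β).D_mul_E i)
      duu := fun i => by
        simp only [C_mul_X_eq_monomial, monomial_mul_monomial, smul_monomial, ← map_add]
        exact congrArg (monomial (1 + 1 + 1)) ((gens α β).duu i)
      ddu := fun i => by
        simp only [C_mul_X_eq_monomial, monomial_mul_monomial, smul_monomial, ← map_add]
        exact congrArg (monomial (1 + 1 + 1)) ((gens α β).ddu i) }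

/-- The homogeneous component of degree `m`. -/
def component (α β : ZMod n → k) (m : ℕ) :
    QuiverDownUpAlgebra α β 0 →ₗ[k] QuiverDownUpAlgebra α β 0 where
  toFun x := (gradingHom α β x).coeff m
  map_add' x y := by simp
  map_smul' c x := by simp

theorem component_apply (m : ℕ) (x : QuiverDownUpAlgebra α β 0) :
    component α β m x = (gradingHom α β x).coeff m := rfl

@[simp] theorem component_e (m : ℕ) (i : ZMod n) :
    component α β m (e α β i) = if m = 0 then e α β i else 0 := by
  rw [component_apply, gradingHom, Gens.lift_e, coeff_C]

@[simp] theorem component_up (m : ℕ) (i : ZMod n) :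
    component α β m (up α β i) = if m = 1 then up α β i else 0 := by
  rw [component_apply, gradingHom, Gens.lift_up, coeff_C_mul_X]

@[simp] theorem component_down (m : ℕ) (i : ZMod n) :
    component α β m (down α β i) = if m = 1 then down α β i else 0 := by
  rw [component_apply, gradingHom, Gens.lift_down, coeff_C_mul_X]

theorem component_zero_mul (x y : QuiverDownUpAlgebra α β 0) :
    component α β 0 (x * y) = component α β 0 x * component α β 0 y := by
  simp [component_apply, mul_coeff_zero]

theorem component_one_mul (x y : QuiverDownUpAlgebra α β 0) :
    component α β 1 (x * y) =
      component α β 0 x * component α β 1 y + component α β 1 x * component α β 0 y := by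
  simp [component_apply, mul_coeff_one]

/-- Three factors without constant term reach total degree three only as `1 + 1 + 1`. -/
theorem component_three_mul {x y z : QuiverDownUpAlgebra α β 0} (hx : component α β 0 x = 0)
    (hy : component α β 0 y = 0) (hz : component α β 0 z = 0) :
    component α β 3 (x * y * z) = component α β 1 x * component α β 1 y * component α β 1 z := by
  rw [component_apply] at hx hy hz
  simp [component_apply, coeff_mul, Finset.Nat.antidiagonal_succ, hx, hy, hz]

/-- The projection to degree zero is an algebra endomorphism, so it is enough to compare on
generators. -/
theorem vertexChar_component_zero (i : ZMod n) (x : QuiverDownUpAlgebra α β 0) :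
    vertexChar α β i (component α β 0 x) = vertexChar α β i x := by
  let f : QuiverDownUpAlgebra α β 0 →ₐ[k] QuiverDownUpAlgebra α β 0 :=
    AlgHom.ofLinearMap (component α β 0) (by simp [component_apply]) component_zero_mul
  have : (vertexChar α β i).comp f = vertexChar α β i := by
    refine algHom_ext ?_ ?_ ?_ <;> intro j <;> simp [f]
  exact DFunLike.congr_fun this x

/-- The ideal generated by the arrows, as a subspace. -/
def arrowIdeal (α β : ZMod n → k) : Submodule k (QuiverDownUpAlgebra α β 0) :=
  LinearMap.ker (component α β 0)

theorem component_one_of_mem_sq {x : QuiverDownUpAlgebra α β 0}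
    (hx : x ∈ arrowIdeal α β * arrowIdeal α β) : component α β 1 x = 0 := by
  induction hx using Submodule.mul_induction_on' with
  | mem_mul_mem a ha b hb =>
    rw [component_one_mul, LinearMap.mem_ker.1 ha, LinearMap.mem_ker.1 hb, zero_mul, mul_zero,
      add_zero]
  | add a _ b _ ha hb => rw [map_add, ha, hb, add_zero]

theorem component_zero_of_mem_sq {x : QuiverDownUpAlgebra α β 0}
    (hx : x ∈ arrowIdeal α β * arrowIdeal α β) : component α β 0 x = 0 := by
  induction hx using Submodule.mul_induction_on' with
  | mem_mul_mem a ha b hb => rw [component_zero_mul, LinearMap.mem_ker.1 ha, zero_mul]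
  | add a _ b _ ha hb => rw [map_add, ha, hb, add_zero]

theorem mkAlgHom_arrow_mem {a b : CyclicVertex n} (f : a ⟶ b) :
    RingQuot.mkAlgHom k (Rel α β 0) (PathAlgebra.ofArrow k f) ∈ arrowIdeal α β := by
  obtain i | i := f
  · exact (component_up 0 i).trans (if_neg zero_ne_one)
  · exact (component_down 0 i).trans (if_neg zero_ne_one)

/-- A path of length at least two is a path ending in an arrow, times an arrow; both factors lie in
`J`. -/
theorem span_sup_sq (α β : ZMod n → k) :
    Submodule.span k (Set.range (e α β)) ⊔ Submodule.span k (Set.range (up α β)) ⊔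
      Submodule.span k (Set.range (down α β)) ⊔ arrowIdeal α β * arrowIdeal α β = ⊤ := by
  rw [eq_top_iff]
  rintro x -
  obtain ⟨x, rfl⟩ := RingQuot.mkAlgHom_surjective k (Rel α β 0) x
  have hx : x ∈ Submodule.span k
      (Set.range fun p : QuiverPath (CyclicVertex n) => PathAlgebra.ofPath k p.path) := by
    rw [PathAlgebra.span_ofPath]; trivial
  induction hx using Submodule.span_induction with
  | zero => rw [map_zero]; exact zero_mem _
  | add x y _ _ hx hy => rw [map_add]; exact add_mem hx hy
  | smul c x _ hx => rw [map_smul]; exact Submodule.smul_mem _ _ hx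
  | mem x hx =>
    obtain ⟨⟨a, b, p⟩, rfl⟩ := hx
    obtain _ | ⟨q, g⟩ := p
    · exact Submodule.mem_sup_left (Submodule.mem_sup_left (Submodule.mem_sup_left
        (Submodule.subset_span ⟨a, rfl⟩)))
    obtain _ | ⟨q, f⟩ := q
    · obtain i | i := g
      · exact Submodule.mem_sup_left (Submodule.mem_sup_left (Submodule.mem_sup_right
          (Submodule.subset_span ⟨i, rfl⟩)))
      · exact Submodule.mem_sup_left (Submodule.mem_sup_right (Submodule.subset_span ⟨i, rfl⟩))
    · refine Submodule.mem_sup_right ?_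
      change RingQuot.mkAlgHom k (Rel α β 0) (PathAlgebra.ofPath k ((q.cons f).cons g)) ∈ _
      rw [PathAlgebra.ofPath_cons, map_mul]
      refine Submodule.mul_mem_mul ?_ (mkAlgHom_arrow_mem g)
      rw [PathAlgebra.ofPath_cons, map_mul]
      have := LinearMap.mem_ker.1 (mkAlgHom_arrow_mem (α := α) (β := β) f)
      rw [arrowIdeal, LinearMap.mem_ker, component_zero_mul, this, mul_zero]

theorem exists_component_eq (x : QuiverDownUpAlgebra α β 0) :
    ∃ a b c : ZMod n → k, component α β 0 x = ∑ i, a i • e α β i ∧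
      component α β 1 x = ∑ i, b i • up α β i + ∑ i, c i • down α β i ∧
      x - component α β 0 x - component α β 1 x ∈ arrowIdeal α β * arrowIdeal α β := by
  have hx : x ∈ (⊤ : Submodule k (QuiverDownUpAlgebra α β 0)) := trivial
  rw [← span_sup_sq α β] at hx
  obtain ⟨x₁, h₁, y, hy, rfl⟩ := Submodule.mem_sup.1 hx
  obtain ⟨x₂, h₂, z, hz, rfl⟩ := Submodule.mem_sup.1 h₁
  obtain ⟨x₃, h₃, w, hw, rfl⟩ := Submodule.mem_sup.1 h₂
  obtain ⟨a, rfl⟩ := Submodule.mem_span_range_iff_exists_fun k |>.1 h₃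
  obtain ⟨b, rfl⟩ := Submodule.mem_span_range_iff_exists_fun k |>.1 hw
  obtain ⟨c, rfl⟩ := Submodule.mem_span_range_iff_exists_fun k |>.1 hz
  have h0 : component α β 0 (∑ i, a i • e α β i + ∑ i, b i • up α β i + ∑ i, c i • down α β i + y) =
      ∑ i, a i • e α β i := by
    simp [map_sum, component_zero_of_mem_sq hy]
  have h1 : component α β 1 (∑ i, a i • e α β i + ∑ i, b i • up α β i + ∑ i, c i • down α β i + y) =
      ∑ i, b i • up α β i + ∑ i, c i • down α β i := by
    simp [map_sum, component_one_of_mem_sq hy]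
  refine ⟨a, b, c, h0, h1, ?_⟩
  rw [h0, h1]
  convert hy using 1
  abel

theorem component_zero_eq (x : QuiverDownUpAlgebra α β 0) :
    component α β 0 x = ∑ i, vertexChar α β i x • e α β i := by
  obtain ⟨a, -, -, h, -⟩ := exists_component_eq x
  rw [h]
  refine Finset.sum_congr rfl fun i _ => ?_
  rw [← vertexChar_component_zero, h]
  simp [map_sum, Pi.single_apply]

/-- Describing `J` by the characters alone makes it visibly invariant under isomorphisms. -/
theorem mem_arrowIdeal_iff {x : QuiverDownUpAlgebra α β 0} :
    x ∈ arrowIdeal α β ↔ ∀ i, vertexChar α β i x = 0 := by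
  refine ⟨fun h i => ?_, fun h => ?_⟩
  · rw [← vertexChar_component_zero, LinearMap.mem_ker.1 h, map_zero]
  · rw [arrowIdeal, LinearMap.mem_ker, component_zero_eq]
    exact Finset.sum_eq_zero fun i _ => by rw [h, zero_smul]

theorem mem_sq_of_component_eq_zero {x : QuiverDownUpAlgebra α β 0} (h0 : component α β 0 x = 0)
    (h1 : component α β 1 x = 0) : x ∈ arrowIdeal α β * arrowIdeal α β := by
  obtain ⟨-, -, -, -, -, h⟩ := exists_component_eq x
  rwa [h0, h1, sub_zero, sub_zero] at h

theorem e_mul_up_mul_e (a b i : ZMod n) :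
    e α β a * up α β i * e α β b = if i = a ∧ b = a + 1 then up α β i else 0 := by
  have h1 : up α β i = e α β i * up α β i := ((gens α β).E_mul_U i).symm
  have h2 : up α β i * e α β (i + 1) = up α β i := (gens α β).U_mul_E i
  have h3 : ∀ i j, i ≠ j → e α β i * e α β j = 0 := (gens α β).E_mul_of_ne
  by_cases h : i = a
  · subst h
    rw [← h1]
    by_cases h' : b = i + 1
    · rw [if_pos ⟨rfl, h'⟩, h', h2]
    · rw [if_neg (by tauto), ← h2, mul_assoc, h3 _ _ (Ne.symm h'), mul_zero]
  · rw [if_neg (by tauto), h1, ← mul_assoc, h3 _ _ (Ne.symm h), zero_mul, zero_mul]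

theorem e_mul_down_mul_e (a b i : ZMod n) :
    e α β a * down α β i * e α β b = if i = b ∧ a = b + 1 then down α β i else 0 := by
  have h1 : down α β i = e α β (i + 1) * down α β i := ((gens α β).E_mul_D i).symm
  have h2 : down α β i * e α β i = down α β i := (gens α β).D_mul_E i
  have h3 : ∀ i j, i ≠ j → e α β i * e α β j = 0 := (gens α β).E_mul_of_ne
  by_cases h : i = b
  · subst h
    rw [mul_assoc, h2]
    by_cases h' : a = i + 1
    · rw [if_pos ⟨rfl, h'⟩, h', ← h1]
    · rw [if_neg (by tauto), h1, ← mul_assoc, h3 _ _ h', zero_mul]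
  · rw [if_neg (by tauto), ← h2, mul_assoc, mul_assoc, h3 _ _ h, mul_zero, mul_zero]

/-- For `n ≥ 3` at most one of the two conditions holds, so the space of arrows between two given
vertices is at most a line. -/
theorem exists_e_mul_component_one_mul_e (x : QuiverDownUpAlgebra α β 0) (a b : ZMod n) :
    ∃ s t : k, e α β a * component α β 1 x * e α β b =
      (if b = a + 1 then s • up α β a else 0) + if a = b + 1 then t • down α β b else 0 := by
  obtain ⟨-, s, t, -, h, -⟩ := exists_component_eq x
  refine ⟨s a, t b, ?_⟩
  simp only [h, mul_add, add_mul, Finset.mul_sum, Finset.sum_mul, mul_smul_comm, smul_mul_assoc,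
    e_mul_up_mul_e, e_mul_down_mul_e, ite_and, smul_ite, smul_zero, Finset.sum_ite_eq',
    Finset.mem_univ, if_true]

end QuiverDownUp

end

/-! ### The leading part of an isomorphism -/

noncomputable section

namespace QuiverDownUp

theorem two_ne_zero_of_three_le {n : ℕ} (hn : 3 ≤ n) : (2 : ZMod n) ≠ 0 := by
  intro h
  have : ((2 : ℕ) : ZMod n) = 0 := by exact_mod_cast h
  rw [ZMod.natCast_eq_zero_iff] at this
  exact absurd (Nat.le_of_dvd two_pos this) (by omega)

variable {k : Type*} [Field k] {n : ℕ} [NeZero n] {α β α' β' : ZMod n → k}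

/-- Induction around the cycle: every element of `ℤ/n` is reached from `i` by adding `1` repeatedly.
-/
theorem forall_of_forall_succ {P : ZMod n → Prop} (h : ∀ i, P i → P (i + 1)) {i : ZMod n}
    (hi : P i) (j : ZMod n) : P j := by
  obtain ⟨m, hm⟩ := ZMod.natCast_zmod_surjective (j - i)
  have : ∀ m : ℕ, P (i + m) := fun m => by
    induction m with
    | zero => simpa using hi
    | succ m ih => rw [Nat.cast_succ, ← add_assoc]; exact h _ ih
  simpa [hm] using this m

/-- The automorphisms of a cycle graph are the rotations and the reflections. -/
theorem rotation_or_reflection (hn : 3 ≤ n) {σ : ZMod n → ZMod n} (hσ : Function.Injective σ)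
    (h : ∀ i, σ (i + 1) = σ i + 1 ∨ σ i = σ (i + 1) + 1) :
    (∃ r, ∀ i, σ i = i - r) ∨ ∃ s, ∀ i, σ i = s - i := by
  have h2 := two_ne_zero_of_three_le hn
  by_cases h0 : ∃ i, σ (i + 1) = σ i + 1
  · obtain ⟨i, hi⟩ := h0
    have hs : ∀ i, σ (i + 1) = σ i + 1 := forall_of_forall_succ (fun i hi => by
      -- A step forward followed by a step back would give `σ (i + 2) = σ i`, against injectivity
      -- since `2 ≠ 0`.
      refine (h (i + 1)).resolve_right fun h' => h2 ?_
      have := hσ (add_right_cancel (hi.symm.trans h'))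
      linear_combination -this) hi
    refine Or.inl ⟨-σ 0, forall_of_forall_succ (i := 0) (fun i hi => ?_) (by simp)⟩
    rw [hs, hi]
    ring
  · push Not at h0
    have hs : ∀ i, σ i = σ (i + 1) + 1 := fun i => (h i).resolve_left (h0 i)
    refine Or.inr ⟨σ 0, forall_of_forall_succ (i := 0) (fun i hi => ?_) (by simp)⟩
    linear_combination hi - hs i

theorem exists_vertexPerm (hn : 2 ≤ n)
    (φ : QuiverDownUpAlgebra α β 0 ≃ₐ[k] QuiverDownUpAlgebra α' β' 0) :
    ∃ σ : ZMod n → ZMod n, Function.Injective σ ∧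
      ∀ i x, vertexChar α' β' (σ i) (φ x) = vertexChar α β i x := by
  choose σ hσ using fun i => eq_vertexChar hn ((vertexChar α β i).comp φ.symm.toAlgHom)
  have h : ∀ i x, vertexChar α' β' (σ i) (φ x) = vertexChar α β i x := fun i x => by
    rw [← hσ]
    simp
  refine ⟨σ, fun i j hij => vertexChar_injective (α := α) (β := β) ?_, h⟩
  refine AlgHom.ext fun x => ?_
  rw [← h, ← h, hij]

theorem map_mem_arrowIdeal (hn : 2 ≤ n)
    (φ : QuiverDownUpAlgebra α β 0 ≃ₐ[k] QuiverDownUpAlgebra α' β' 0)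
    {x : QuiverDownUpAlgebra α β 0} (hx : x ∈ arrowIdeal α β) : φ x ∈ arrowIdeal α' β' := by
  obtain ⟨σ, hσ, h⟩ := exists_vertexPerm hn φ
  rw [mem_arrowIdeal_iff] at hx ⊢
  intro j
  obtain ⟨i, rfl⟩ := Finite.surjective_of_injective hσ j
  rw [h, hx]

theorem map_mem_arrowIdeal_sq (hn : 2 ≤ n)
    (φ : QuiverDownUpAlgebra α β 0 ≃ₐ[k] QuiverDownUpAlgebra α' β' 0)
    {x : QuiverDownUpAlgebra α β 0} (hx : x ∈ arrowIdeal α β * arrowIdeal α β) :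
    φ x ∈ arrowIdeal α' β' * arrowIdeal α' β' := by
  induction hx using Submodule.mul_induction_on' with
  | mem_mul_mem a ha b hb =>
    rw [map_mul]
    exact Submodule.mul_mem_mul (map_mem_arrowIdeal hn φ ha) (map_mem_arrowIdeal hn φ hb)
  | add a _ b _ ha hb => rw [map_add]; exact add_mem ha hb

theorem up_mem_arrowIdeal (i : ZMod n) : up α β i ∈ arrowIdeal α β := by
  simp [arrowIdeal]

theorem down_mem_arrowIdeal (i : ZMod n) : down α β i ∈ arrowIdeal α β := by
  simp [arrowIdeal]

/-- An isomorphism induces an injective map on `J / J²`, where `J` is the ideal generated by the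
arrows. -/
theorem component_one_map_ne_zero (hn : 2 ≤ n)
    (φ : QuiverDownUpAlgebra α β 0 ≃ₐ[k] QuiverDownUpAlgebra α' β' 0)
    {x : QuiverDownUpAlgebra α β 0} (hx : x ∈ arrowIdeal α β) (hx1 : component α β 1 x ≠ 0) :
    component α' β' 1 (φ x) ≠ 0 := by
  intro h
  have h1 := map_mem_arrowIdeal_sq hn φ.symm
    (mem_sq_of_component_eq_zero (map_mem_arrowIdeal hn φ hx) h)
  rw [AlgEquiv.symm_apply_apply] at h1
  exact hx1 (component_one_of_mem_sq h1)

theorem component_three_map_mul (hn : 2 ≤ n)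
    (φ : QuiverDownUpAlgebra α β 0 ≃ₐ[k] QuiverDownUpAlgebra α' β' 0)
    {x y z : QuiverDownUpAlgebra α β 0} (hx : x ∈ arrowIdeal α β) (hy : y ∈ arrowIdeal α β)
    (hz : z ∈ arrowIdeal α β) : component α' β' 3 (φ (x * y * z)) =
      component α' β' 1 (φ x) * component α' β' 1 (φ y) * component α' β' 1 (φ z) := by
  rw [map_mul φ, map_mul φ]
  exact component_three_mul (map_mem_arrowIdeal hn φ hx) (map_mem_arrowIdeal hn φ hy)
    (map_mem_arrowIdeal hn φ hz)

theorem component_zero_map_e {φ : QuiverDownUpAlgebra α β 0 ≃ₐ[k] QuiverDownUpAlgebra α' β' 0}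
    {σ : ZMod n → ZMod n} (hσ : Function.Injective σ)
    (h : ∀ i x, vertexChar α' β' (σ i) (φ x) = vertexChar α β i x) (i : ZMod n) :
    component α' β' 0 (φ (e α β i)) = e α' β' (σ i) := by
  rw [component_zero_eq, Finset.sum_eq_single (σ i)]
  · simp [h]
  · intro j _ hj
    obtain ⟨l, rfl⟩ := Finite.surjective_of_injective hσ j
    have : i ≠ l := fun h => hj (by rw [h])
    simp [h, this]
  · simp

/-- The idempotent `φ (e_i)` agrees with `e_{σ i}` only modulo `J`. This is enough: `φ x` has no
constant term, so its degree-one part sees only the constant terms of the idempotents. -/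
theorem component_one_map_of_mul (hn : 2 ≤ n)
    {φ : QuiverDownUpAlgebra α β 0 ≃ₐ[k] QuiverDownUpAlgebra α' β' 0}
    {σ : ZMod n → ZMod n} (hσ : Function.Injective σ)
    (h : ∀ i x, vertexChar α' β' (σ i) (φ x) = vertexChar α β i x)
    {x : QuiverDownUpAlgebra α β 0} (hx : x ∈ arrowIdeal α β) {i j : ZMod n}
    (hl : e α β i * x = x) (hr : x * e α β j = x) :
    component α' β' 1 (φ x) =
      e α' β' (σ i) * component α' β' 1 (φ x) * e α' β' (σ j) := by
  have h0 : component α' β' 0 (φ x) = 0 := map_mem_arrowIdeal hn φ hx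
  conv_lhs => rw [← hr, map_mul, component_one_mul, h0, zero_mul, zero_add,
    component_zero_map_e hσ h, ← hl, map_mul, component_one_mul, h0, mul_zero, add_zero,
    component_zero_map_e hσ h]

theorem component_one_map_up (hn : 3 ≤ n) (hβ : ∀ i, β i ≠ 0)
    {φ : QuiverDownUpAlgebra α β 0 ≃ₐ[k] QuiverDownUpAlgebra α' β' 0}
    {σ : ZMod n → ZMod n} (hσ : Function.Injective σ)
    (h : ∀ i x, vertexChar α' β' (σ i) (φ x) = vertexChar α β i x) (i : ZMod n) :
    (σ (i + 1) = σ i + 1 ∧ ∃ p : k, p ≠ 0 ∧ component α' β' 1 (φ (up α β i)) = p • up α' β' (σ i)) ∨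
    (σ i = σ (i + 1) + 1 ∧
      ∃ p : k, p ≠ 0 ∧ component α' β' 1 (φ (up α β i)) = p • down α' β' (σ (i + 1))) := by
  have h0 := component_one_map_ne_zero (by omega) φ (up_mem_arrowIdeal i)
    (by simpa using up_ne_zero hβ i)
  have h1 := component_one_map_of_mul (by omega) hσ h (up_mem_arrowIdeal i)
    ((gens α β).E_mul_U i) ((gens α β).U_mul_E i)
  obtain ⟨s, t, hst⟩ :=
    exists_e_mul_component_one_mul_e (φ (up α β i)) (σ i) (σ (i + 1))
  rw [← h1] at hst
  by_cases c1 : σ (i + 1) = σ i + 1 <;> by_cases c2 : σ i = σ (i + 1) + 1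
  · refine absurd ?_ (two_ne_zero_of_three_le hn)
    linear_combination -c1 - c2
  · rw [if_pos c1, if_neg c2, add_zero] at hst
    exact Or.inl ⟨c1, s, fun hs => h0 (by rw [hst, hs, zero_smul]), hst⟩
  · rw [if_neg c1, if_pos c2, zero_add] at hst
    exact Or.inr ⟨c2, t, fun hs => h0 (by rw [hst, hs, zero_smul]), hst⟩
  · rw [if_neg c1, if_neg c2, add_zero] at hst
    exact absurd hst h0

theorem component_one_map_down (hn : 3 ≤ n) (hβ : ∀ i, β i ≠ 0)
    {φ : QuiverDownUpAlgebra α β 0 ≃ₐ[k] QuiverDownUpAlgebra α' β' 0}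
    {σ : ZMod n → ZMod n} (hσ : Function.Injective σ)
    (h : ∀ i x, vertexChar α' β' (σ i) (φ x) = vertexChar α β i x) (i : ZMod n) :
    (σ (i + 1) = σ i + 1 ∧
      ∃ q : k, q ≠ 0 ∧ component α' β' 1 (φ (down α β i)) = q • down α' β' (σ i)) ∨
    (σ i = σ (i + 1) + 1 ∧
      ∃ q : k, q ≠ 0 ∧ component α' β' 1 (φ (down α β i)) = q • up α' β' (σ (i + 1))) := by
  have h0 := component_one_map_ne_zero (by omega) φ (down_mem_arrowIdeal i)
    (by simpa using down_ne_zero hβ i)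
  have h1 := component_one_map_of_mul (by omega) hσ h (down_mem_arrowIdeal i)
    ((gens α β).E_mul_D i) ((gens α β).D_mul_E i)
  obtain ⟨s, t, hst⟩ :=
    exists_e_mul_component_one_mul_e (φ (down α β i)) (σ (i + 1)) (σ i)
  rw [← h1] at hst
  by_cases c1 : σ (i + 1) = σ i + 1 <;> by_cases c2 : σ i = σ (i + 1) + 1
  · refine absurd ?_ (two_ne_zero_of_three_le hn)
    linear_combination -c1 - c2
  · rw [if_neg c2, if_pos c1, zero_add] at hst
    exact Or.inl ⟨c1, t, fun hs => h0 (by rw [hst, hs, zero_smul]), hst⟩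
  · rw [if_pos c2, if_neg c1, add_zero] at hst
    exact Or.inr ⟨c2, s, fun hs => h0 (by rw [hst, hs, zero_smul]), hst⟩
  · rw [if_neg c1, if_neg c2, add_zero] at hst
    exact absurd hst h0

/-- The relation is homogeneous cubic, so the degree-one parts of the images of the arrows satisfy
it again. -/
theorem component_three_map_duu (hn : 2 ≤ n)
    (φ : QuiverDownUpAlgebra α β 0 ≃ₐ[k] QuiverDownUpAlgebra α' β' 0)
    {U D : ZMod n → QuiverDownUpAlgebra α' β' 0}
    (hU : ∀ i, component α' β' 1 (φ (up α β i)) = U i)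
    (hD : ∀ i, component α' β' 1 (φ (down α β i)) = D i) (i : ZMod n) :
    D (i - 1) * U (i - 1) * U i
      = α i • (U i * D i * U i) + β i • (U i * U (i + 1) * D (i + 1)) := by
  have hu := up_mem_arrowIdeal (α := α) (β := β)
  have hd := down_mem_arrowIdeal (α := α) (β := β)
  have : component α' β' 3 (φ (down α β (i - 1) * up α β (i - 1) * up α β i)) = component α' β' 3
      (φ (α i • (up α β i * down α β i * up α β i) +
        β i • (up α β i * up α β (i + 1) * down α β (i + 1)))) :=
    congrArg (fun x => component α' β' 3 (φ x)) ((gens α β).duu i)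
  rw [map_add, map_add, map_smul, map_smul, map_smul, map_smul,
    component_three_map_mul hn φ (hd _) (hu _) (hu _),
    component_three_map_mul hn φ (hu _) (hd _) (hu _),
    component_three_map_mul hn φ (hu _) (hu _) (hd _)] at this
  simpa only [hU, hD] using this

theorem rotate_or_reflect_of_algEquiv (hn : 3 ≤ n) (hβ : ∀ i, β i ≠ 0) (hβ' : ∀ i, β' i ≠ 0)
    (φ : QuiverDownUpAlgebra α β 0 ≃ₐ[k] QuiverDownUpAlgebra α' β' 0) :
    ∃ l : ZMod n → k, (∀ i, l i ≠ 0) ∧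
      ((∃ r, ∀ i, α' (i - r) * l (i - 1) = α i * l i ∧
        β' (i - r) * l (i - 1) = β i * l (i + 1)) ∨
      ∃ s, ∀ i, α' (s - i - 1) * (β i * l (i + 1)) = -(α i * l i) ∧
        β' (s - i - 1) * (β i * l (i + 1)) = l (i - 1)) := by
  obtain ⟨σ, hσ, h⟩ := exists_vertexPerm (by omega) φ
  have hu := component_one_map_up hn hβ hσ h
  have hd := component_one_map_down hn hβ hσ h
  have h2 := two_ne_zero_of_three_le hn
  obtain ⟨r, hr⟩ | ⟨s, hs⟩ :=
    rotation_or_reflection hn hσ fun i => (hu i).imp And.left And.left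
  · have hne : ∀ i, σ i ≠ σ (i + 1) + 1 := fun i hi => h2 (by
      rw [hr, hr] at hi
      linear_combination -hi)
    choose p hp hU using fun i => ((hu i).resolve_right fun h => hne i h.1).2
    choose q hq hD using fun i => ((hd i).resolve_right fun h => hne i h.1).2
    -- Each equation to be proved appears in `key` multiplied by the extra factor `p i`.
    refine ⟨p * q, fun i => mul_ne_zero (hp i) (hq i), Or.inl ⟨r, fun i => ?_⟩⟩
    have key := component_three_map_duu (by omega) φ hU hD i
    have rel : down α' β' (i - r - 1) * up α' β' (i - r - 1) * up α' β' (i - r) =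
      α' (i - r) • (up α' β' (i - r) * down α' β' (i - r) * up α' β' (i - r)) +
      β' (i - r) • (up α' β' (i - r) * up α' β' (i - r + 1) * down α' β' (i - r + 1)) :=
        (gens α' β').duu (i - r)
    rw [hr, hr, hr, sub_right_comm, add_sub_right_comm] at key
    simp only [smul_mul_assoc, mul_smul_comm, smul_smul, rel, smul_add] at key
    rw [← sub_eq_zero, add_sub_add_comm, ← sub_smul, ← sub_smul] at key
    obtain ⟨k1, k2⟩ := udu_uud_independent hβ' _ key
    constructor
    · refine mul_left_cancel₀ (hp i) ?_
      simp only [Pi.mul_apply]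
      linear_combination k1
    · refine mul_left_cancel₀ (hp i) ?_
      simp only [Pi.mul_apply]
      linear_combination k2
  · have hne : ∀ i, σ (i + 1) ≠ σ i + 1 := fun i hi => h2 (by
      rw [hs, hs] at hi
      linear_combination -hi)
    choose p hp hU using fun i => ((hu i).resolve_left fun h => hne i h.1).2
    choose q hq hD using fun i => ((hd i).resolve_left fun h => hne i h.1).2
    refine ⟨p * q, fun i => mul_ne_zero (hp i) (hq i), Or.inr ⟨s, fun i => ?_⟩⟩
    have key := component_three_map_duu (by omega) φ hU hD i
    -- The reflected `duu` is a relation among paths of shape `udd`, `dud`, `ddu`; the `ddu`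
    -- relation of the target removes the last.
    have rel : down α' β' (s - i - 1) * down α' β' (s - i - 1 - 1) * up α' β' (s - i - 1 - 1) =
      α' (s - i - 1) • (down α' β' (s - i - 1) * up α' β' (s - i - 1) * down α' β' (s - i - 1)) +
      β' (s - i - 1) • (up α' β' (s - i - 1 + 1) * down α' β' (s - i - 1 + 1) *
        down α' β' (s - i - 1)) := (gens α' β').ddu (s - i - 1)
    have e1 : s - (i - 1 + 1) = s - i - 1 + 1 := by ring
    have e2 : s - (i + 1) = s - i - 1 := by ring
    have e3 : s - (i + 1 + 1) = s - i - 1 - 1 := by ring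
    rw [hs, hs, hs, e1, e2, e3] at key
    simp only [smul_mul_assoc, mul_smul_comm, smul_smul, rel, smul_add] at key
    rw [← add_assoc, ← add_smul, eq_comm, ← sub_eq_zero, add_sub_assoc, ← sub_smul] at key
    obtain ⟨k1, k2⟩ := dud_udd_independent hβ' _ key
    constructor
    · refine mul_left_cancel₀ (hp i) ?_
      simp only [Pi.mul_apply]
      linear_combination k1
    · refine mul_left_cancel₀ (hp i) ?_
      simp only [Pi.mul_apply]
      linear_combination k2

end QuiverDownUp

end

/-! ### The classification -/

theorem theorem5p2 {k : Type*} [Field k] [IsAlgClosed k] [CharZero k]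
    (n : ℕ) [NeZero n] (hn : 3 ≤ n)
    (α α' β β' : ZMod n → k) (hβ : ∀ i, β i ≠ 0) (hβ' : ∀ i, β' i ≠ 0) :
    Nonempty (QuiverDownUpAlgebra α β 0 ≃ₐ[k] QuiverDownUpAlgebra α' β' 0) ↔
      ∃ l : ZMod n → k, (∀ i, l i ≠ 0) ∧ ∃ r : ZMod n,
        (∀ i, α' i = l (i + r) * (l (i + r - 1))⁻¹ * α (i + r) ∧
          β' i = l (i + r + 1) * (l (i + r - 1))⁻¹ * β (i + r)) ∨
        (∀ i, α' i = -((l (-i - r))⁻¹ * l (-i - r - 1) * (β (-i - r - 1))⁻¹ * α (-i - r - 1)) ∧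
          β' i = (l (-i - r))⁻¹ * l (-i - r - 2) * (β (-i - r - 1))⁻¹) := by
  constructor
  · rintro ⟨φ⟩
    obtain ⟨l, hl, ⟨r, hr⟩ | ⟨s, hs⟩⟩ := QuiverDownUp.rotate_or_reflect_of_algEquiv hn hβ hβ' φ
    · refine ⟨l, hl, r, Or.inl fun i => ?_⟩
      obtain ⟨h1, h2⟩ := hr (i + r)
      rw [add_sub_cancel_right] at h1 h2
      have := hl (i + r - 1)
      constructor
      · field_simp
        linear_combination h1
      · field_simp
        linear_combination h2
    -- The reflection `i ↦ s - i` corresponds to `r = -s`. The equations are used at the arrow index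
    -- `s - i - 1`, whose mirror image is `i`.
    · refine ⟨l, hl, -s, Or.inr fun i => ?_⟩
      obtain ⟨h1, h2⟩ := hs (-i - -s - 1)
      have e1 : s - (-i - -s - 1) - 1 = i := by ring
      have e2 : -i - -s - 1 - 1 = -i - -s - 2 := by ring
      rw [e1, sub_add_cancel] at h1 h2
      rw [e2] at h2
      have := hl (-i - -s)
      have := hβ (-i - -s - 1)
      constructor
      · field_simp
        linear_combination h1
      · field_simp
        linear_combination h2
  · rintro ⟨l, hl, r, h | h⟩
    · refine QuiverDownUp.algEquiv_of_rotate r l hl (fun i => ?_) fun i => ?_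
      · have := hl (i - 1)
        rw [(h (i - r)).1, sub_add_cancel]
        field_simp
      · have := hl (i - 1)
        rw [(h (i - r)).2, sub_add_cancel]
        field_simp
    · have e1 (i : ZMod n) : -(-r - i - 1) - r = i + 1 := by ring
      have e2 (i : ZMod n) : i + 1 - 2 = i - 1 := by ring
      refine QuiverDownUp.algEquiv_of_reflect hβ (-r) l hl (fun i => ?_) fun i => ?_
      · have := hl (i + 1)
        have := hβ i
        rw [(h (-r - i - 1)).1, e1, add_sub_cancel_right]
        field_simp
      · have := hl (i + 1)
        have := hβ i
        rw [(h (-r - i - 1)).2, e1, e2, add_sub_cancel_right]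
        field_simp
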